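/- Let $\mu$ be a positive Borel measure on $\mathbb{R}$ with $\int \exp(\delta|x|)\,d\mu(x)<\infty$ for some $\delta>0$ (so that $\mu$ is identifiable by its moments), and let $\{\alpha_n\}_{n\ge 0}$ be real polynomials, $\deg\alpha_n=n$, orthogonal with respect to $\mu$, with $\hat\alpha_n=\int\alpha_n^2\,d\mu>0$ for all $n$. Let $S\subseteq\mathbb{R}$ be closed and let $h_n$, $n\ge 0$, be real functions with $\sum_{n\ge0}|h_n(y)|^2/\hat\alpha_n<\infty$ for every $y\in S$. Then for every $y\in S$ the series $$g(x,y)=\sum_{n\ge 0}h_n(y)\,\alpha_n(x)/\hat\alpha_n$$ converges in mean square with respect to $\mu$, and the following hold. (i) For all $y\in S$ the sum $g(\cdot,y)$ is nonnegative $\mu$-almost everywhere if and only if there is a family of finite positive measures $\zeta(\cdot|y)$, $y\in S$, with $\zeta(\cdot|y)\ll\mu$ and $$h_n(y)=\int\alpha_n(x)\,\zeta(dx|y)\qquad\text{for all } n\ge0,\ y\in S. \tag{$*$}$$ The family can be chosen to consist of probability measures if and only if, for all $y\in S$, $g(\cdot,y)\ge 0$ $\mu$-almost everywhere and $h_0(y)=\alpha_0$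 (that is, $\int g(x,y)\,d\mu(x)=1$). (ii) Every family of finite positive measures $\zeta(\cdot|y)\ll\mu$ satisfying $(*)$ is given by $d\zeta(x|y)=g(x,y)\,d\mu(x)$, $y\in S$. (iii) Suppose in addition that $\mu$ is a probability measure, that the $\zeta(\cdot|y)\ll\mu$, $y\in S$, are probability measures satisfying $(*)$, and that $\nu$ is a probability measure concentrated on $S$ such that every $h_n$ is $\nu$-integrable and $\int_S h_n\,d\nu=\delta_{n,0}$ for all $n\ge0$. Then, for every Borel set $A$, the map $y\mapsto\zeta(A|y)$ is $\nu$-measurable and $$\mu(A)=\int_S\zeta(A|y)\,d\nu(y).$$ Moreover, after changing $g(\cdot,y)$ on a $\mu$-null set for each $y \in S$, $g$ is $\mu\times\nu$-measurable, and $$F(dx,dy)=\zeta(dx|y)\,d\nu(y)=g(x,y)\,d\mu(x)\,d\nu(y)$$ defines a bivariate probability measure $F\ll\mu\times\nu$ whose marginals are $\mu$ and $\nu$. -/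

import Mathlib

open MeasureTheory Filter Topology
open scoped ENNReal

/-- `μ` has a finite exponential moment, `∫ exp (δ |x|) dμ < ∞` for some `δ > 0`. In particular `μ`
is finite, has moments of all orders, and is identifiable by its moments. -/
def HasExpMoment (μ : Measure ℝ) : Prop :=
  ∃ δ : ℝ, 0 < δ ∧ Integrable (fun x : ℝ => Real.exp (δ * |x|)) μ

/-- The squared norm `∫ p² dμ` of a polynomial. -/
noncomputable def normSqPoly (μ : Measure ℝ) (p : Polynomial ℝ) : ℝ :=
  ∫ x, (p.eval x) ^ 2 ∂μ

/-- `α 0, α 1, α 2, …` is a sequence of orthogonal polynomials of `μ`, with no prescribed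
normalization: `α n` has degree `n`, is orthogonal to the other members of the sequence, and has
positive norm. -/
structure IsOrthogonalPolynomials (μ : Measure ℝ) (α : ℕ → Polynomial ℝ) : Prop where
  natDegree_eq : ∀ n, (α n).natDegree = n
  orthogonal : ∀ m n, m ≠ n → ∫ x, (α m).eval x * (α n).eval x ∂μ = 0
  normSq_pos : ∀ n, 0 < normSqPoly μ (α n)

/-- The series `∑ c n * α n (x) / ‖α n‖²` converges to `g` in mean square with respect to `μ`. -/
def ConvergesInMeanSquare (μ : Measure ℝ) (α : ℕ → Polynomial ℝ) (c : ℕ → ℝ) (g : ℝ → ℝ) : Prop :=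
  MemLp g 2 μ ∧
    Tendsto (fun N : ℕ => eLpNorm (fun x =>
      (∑ n ∈ Finset.range N, c n * (α n).eval x / normSqPoly μ (α n)) - g x) 2 μ) atTop (𝓝 0)

/-- `ζ` is a finite positive measure, absolutely continuous with respect to `μ`, for which
`∫ α n dζ` exists and equals `c n` for every `n`. -/
structure RepresentsCoefficients (μ : Measure ℝ) (α : ℕ → Polynomial ℝ) (c : ℕ → ℝ)
    (ζ : Measure ℝ) : Prop where
  isFinite : IsFiniteMeasure ζ
  absolutelyContinuous : ζ ≪ μ
  integrable : ∀ n, Integrable (fun x => (α n).eval x) ζ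
  coeff_eq : ∀ n, c n = ∫ x, (α n).eval x ∂ζ

/-! The coefficients `h n y` fix the integrals of all polynomials, because the `α n` span them.
Hence a representing `ζ` has the same moments as the signed measure `g dμ`, and everything rests on
moment determinacy (`HasExpMoment.eq_of_moments`). Since that result concerns positive measures, `g`
is split: `g⁺ dμ` and `ζ + g⁻ dμ` are positive with equal moments. By Cauchy–Schwarz, `g ∈ L²(μ)`
gives `g⁺ dμ` a finite exponential moment, so the two coincide
(`RepresentsCoefficients.add_withDensity`). Thus `g⁻ ≤ g⁺` a.e., so `g ≥ 0` and `ζ = g dμ`. The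
converse is Parseval: the coefficients of the L² sum are the given ones.

For the mixture, `ζ(A|y)` is a limit of partial sums in the `h n y`, hence measurable up to null
sets. Averaging the coefficients over `ν` yields the moments of `μ`, and determinacy identifies the
mixture with `μ`. The Radon–Nikodym derivative for kernels supplies a jointly measurable density. -/

/-- A finite exponential moment makes the measure finite. -/
lemma HasExpMoment.isFiniteMeasure {μ : Measure ℝ} (hμ : HasExpMoment μ) : IsFiniteMeasure μ := by
  obtain ⟨δ, hδ, hint⟩ := hμ
  have h1 : Integrable (fun _ : ℝ => (1 : ℝ)) μ := by
    refine hint.mono (by fun_prop) (ae_of_all _ fun x => ?_)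
    rw [norm_one, Real.norm_eq_abs, abs_of_pos (Real.exp_pos _)]
    exact Real.one_le_exp (by positivity)
  simpa [integrable_const_iff] using h1

/-! ### Moment determinacy under an exponential moment -/

lemma HasExpMoment.exists_Icc_subset {μ : Measure ℝ} (hμ : HasExpMoment μ) :
    ∃ δ : ℝ, 0 < δ ∧ Set.Icc (-δ) δ ⊆ ProbabilityTheory.integrableExpSet id μ := by
  obtain ⟨δ, hδ, hint⟩ := hμ
  refine ⟨δ, hδ, fun t ht => ?_⟩
  refine hint.mono (by fun_prop) (ae_of_all _ fun x => ?_)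
  simp only [Real.norm_eq_abs, Real.abs_exp, id]
  refine Real.exp_le_exp.2 ((le_abs_self _).trans ?_)
  rw [abs_mul]
  exact mul_le_mul_of_nonneg_right (abs_le.2 ht) (abs_nonneg x)

lemma HasExpMoment.zero_mem_interior {μ : Measure ℝ} (hμ : HasExpMoment μ) :
    (0 : ℝ) ∈ interior (ProbabilityTheory.integrableExpSet id μ) := by
  obtain ⟨δ, hδ, hsub⟩ := hμ.exists_Icc_subset
  refine interior_mono hsub ?_
  rw [interior_Icc]
  exact ⟨by linarith, hδ⟩

/-- Measures with finite exponential moments and the same moments are equal. -/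
lemma HasExpMoment.ext_of_moments {μ₁ μ₂ : Measure ℝ} (h₁ : HasExpMoment μ₁)
    (h₂ : HasExpMoment μ₂) (h : ∀ n : ℕ, ∫ x, x ^ n ∂μ₁ = ∫ x, x ^ n ∂μ₂) : μ₁ = μ₂ := by
  have := h₁.isFiniteMeasure
  have := h₂.isFiniteMeasure
  have m₁ := h₁.zero_mem_interior
  have m₂ := h₂.zero_mem_interior
  set I : Set ℝ := interior (ProbabilityTheory.integrableExpSet id μ₁) ∩
    interior (ProbabilityTheory.integrableExpSet id μ₂) with hI
  have hconv : Convex ℝ I := ProbabilityTheory.convex_integrableExpSet.interior.inter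
    ProbabilityTheory.convex_integrableExpSet.interior
  have a₁ := ProbabilityTheory.analyticAt_complexMGF (X := id) (μ := μ₁) (z := 0) (by simpa)
  have a₂ := ProbabilityTheory.analyticAt_complexMGF (X := id) (μ := μ₂) (z := 0) (by simpa)
  have hd (n : ℕ) : iteratedDeriv n (ProbabilityTheory.complexMGF id μ₁) 0 =
      iteratedDeriv n (ProbabilityTheory.complexMGF id μ₂) 0 := by
    rw [ProbabilityTheory.iteratedDeriv_complexMGF (by simpa),
      ProbabilityTheory.iteratedDeriv_complexMGF (by simpa)]
    have key (μ : Measure ℝ) :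
        ∫ x : ℝ, ((id x : ℝ) : ℂ) ^ n * Complex.exp (0 * ((id x : ℝ) : ℂ)) ∂μ =
        ((∫ x, x ^ n ∂μ : ℝ) : ℂ) := by
      rw [← integral_complex_ofReal]
      simp
    rw [key, key, h n]
  have s₁ := a₁.hasFPowerSeriesAt
  have s₂ := a₂.hasFPowerSeriesAt
  simp_rw [hd] at s₁
  have hev : ProbabilityTheory.complexMGF id μ₁ =ᶠ[𝓝 0] ProbabilityTheory.complexMGF id μ₂ := by
    filter_upwards [s₁.eventually_hasSum_sub, s₂.eventually_hasSum_sub] with z e₁ e₂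
    exact e₁.unique e₂
  -- Identity theorem on a vertical strip: equal Taylor coefficients at 0 give equality near 0, and
  -- the strip is convex. It contains the imaginary axis, where the complex MGF is the
  -- characteristic function.
  have heq : Set.EqOn (ProbabilityTheory.complexMGF id μ₁) (ProbabilityTheory.complexMGF id μ₂)
      {z : ℂ | z.re ∈ I} := by
    refine AnalyticOnNhd.eqOn_of_preconnected_of_eventuallyEq (z₀ := 0)
      (ProbabilityTheory.analyticOnNhd_complexMGF.mono fun z hz => hz.1)
      (ProbabilityTheory.analyticOnNhd_complexMGF.mono fun z hz => hz.2)
      (hconv.linear_preimage Complex.reLm).isPreconnected ⟨by simpa, by simpa⟩ hev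
  refine Measure.ext_of_charFun (funext fun t => ?_)
  rw [← ProbabilityTheory.complexMGF_id_mul_I, ← ProbabilityTheory.complexMGF_id_mul_I]
  exact heq ⟨by simpa, by simpa⟩

/-- Finiteness of an exponential moment can be read off from the moments. -/
lemma HasExpMoment.of_moments {μ₁ μ₂ : Measure ℝ} (h₁ : HasExpMoment μ₁)
    (hi : ∀ n : ℕ, Integrable (fun x : ℝ => x ^ n) μ₂)
    (h : ∀ n : ℕ, ∫ x, x ^ n ∂μ₁ = ∫ x, x ^ n ∂μ₂) : HasExpMoment μ₂ := by
  have hi₁ (n : ℕ) : Integrable (fun x : ℝ => x ^ n) μ₁ := by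
    simpa using ProbabilityTheory.integrable_pow_of_mem_interior_integrableExpSet
      h₁.zero_mem_interior n
  obtain ⟨δ, hδ, hint⟩ := h₁
  -- `cosh` is comparable to `exp (δ|x|)`, and its series has only nonnegative terms. Tonelli then
  -- expresses its integral through even moments, without prior integrability.
  have hcosh (x : ℝ) : HasSum (fun n : ℕ => (δ * x) ^ (2 * n) / ((2 * n).factorial : ℝ))
      (Real.cosh (δ * x)) := Real.hasSum_cosh _
  have hnn (x : ℝ) (n : ℕ) : 0 ≤ (δ * x) ^ (2 * n) / ((2 * n).factorial : ℝ) :=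
    div_nonneg ((even_two_mul n).pow_nonneg _) (by positivity)
  have hterm (μ : Measure ℝ) (hm : ∀ n : ℕ, Integrable (fun x : ℝ => x ^ n) μ) (n : ℕ) :
      ∫⁻ x, ENNReal.ofReal ((δ * x) ^ (2 * n) / ((2 * n).factorial : ℝ)) ∂μ =
        ENNReal.ofReal (δ ^ (2 * n) / ((2 * n).factorial : ℝ) * ∫ x, x ^ (2 * n) ∂μ) := by
    have e (x : ℝ) : (δ * x) ^ (2 * n) / ((2 * n).factorial : ℝ) =
      δ ^ (2 * n) / ((2 * n).factorial : ℝ) * x ^ (2 * n) := by ring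
    have hI : Integrable (fun x : ℝ => (δ * x) ^ (2 * n) / ((2 * n).factorial : ℝ)) μ := by
      simp_rw [e]
      exact (hm _).const_mul _
    rw [← ofReal_integral_eq_lintegral_ofReal hI (ae_of_all _ fun x => hnn x n)]
    simp_rw [e]
    rw [integral_const_mul]
  have hsum (μ : Measure ℝ) (hm : ∀ n : ℕ, Integrable (fun x : ℝ => x ^ n) μ) :
      ∫⁻ x, ENNReal.ofReal (Real.cosh (δ * x)) ∂μ = ∑' n : ℕ,
        ENNReal.ofReal (δ ^ (2 * n) / ((2 * n).factorial : ℝ) * ∫ x, x ^ (2 * n) ∂μ) := by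
    simp_rw [← hterm μ hm]
    rw [← lintegral_tsum fun n => by fun_prop]
    refine lintegral_congr fun x => ?_
    rw [← (hcosh x).tsum_eq, ENNReal.ofReal_tsum_of_nonneg (hnn x) (hcosh x).summable]
  have hexp (x : ℝ) : Real.exp (δ * |x|) ≤ 2 * Real.cosh (δ * x) := by
    rw [Real.cosh_eq]
    rcases abs_choice x with hx | hx <;> rw [hx]
    · nlinarith [Real.exp_pos (-(δ * x))]
    · rw [mul_neg]
      nlinarith [Real.exp_pos (δ * x)]
  have hcle (x : ℝ) : Real.cosh (δ * x) ≤ Real.exp (δ * |x|) := by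
    rw [← Real.cosh_abs, abs_mul, abs_of_pos hδ]
    rw [Real.cosh_eq]
    have : Real.exp (-(δ * |x|)) ≤ Real.exp (δ * |x|) :=
      Real.exp_le_exp.2 (by nlinarith [abs_nonneg x])
    linarith
  have hc₁ : Integrable (fun x => Real.cosh (δ * x)) μ₁ := by
    refine hint.mono (by fun_prop) (ae_of_all _ fun x => ?_)
    rw [Real.norm_eq_abs, Real.norm_eq_abs, Real.abs_exp, abs_of_pos (Real.cosh_pos _)]
    exact hcle x
  have hc₂ : Integrable (fun x => Real.cosh (δ * x)) μ₂ := by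
    refine ⟨by fun_prop, ?_⟩
    rw [hasFiniteIntegral_iff_ofReal (ae_of_all _ fun x => (Real.cosh_pos _).le), hsum μ₂ hi]
    simp_rw [← h]
    rw [← hsum μ₁ hi₁]
    exact (hasFiniteIntegral_iff_ofReal (ae_of_all _ fun x => (Real.cosh_pos _).le)).1 hc₁.2
  refine ⟨δ, hδ, (hc₂.const_mul 2).mono (by fun_prop) (ae_of_all _ fun x => ?_)⟩
  rw [Real.norm_eq_abs, Real.norm_eq_abs, Real.abs_exp,
    abs_of_pos (mul_pos two_pos (Real.cosh_pos _))]
  exact hexp x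

/-- A measure with a finite exponential moment is determined by its moments. -/
lemma HasExpMoment.eq_of_moments {μ₁ μ₂ : Measure ℝ} (h₁ : HasExpMoment μ₁)
    (hi : ∀ n : ℕ, Integrable (fun x : ℝ => x ^ n) μ₂)
    (h : ∀ n : ℕ, ∫ x, x ^ n ∂μ₁ = ∫ x, x ^ n ∂μ₂) : μ₁ = μ₂ :=
  h₁.ext_of_moments (h₁.of_moments hi h) h

/-! ### Polynomials and orthogonal series in L² -/

lemma integrable_eval_of_integrable_pow {μ : Measure ℝ}
    (hi : ∀ n : ℕ, Integrable (fun x : ℝ => x ^ n) μ) (p : Polynomial ℝ) :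
    Integrable (fun x => p.eval x) μ := by
  simp_rw [Polynomial.eval_eq_sum_range]
  exact integrable_finsetSum _ fun n _ => (hi n).const_mul _

lemma HasExpMoment.integrable_eval {μ : Measure ℝ} (hμ : HasExpMoment μ) (p : Polynomial ℝ) :
    Integrable (fun x => p.eval x) μ :=
  integrable_eval_of_integrable_pow (fun n => by
    simpa using ProbabilityTheory.integrable_pow_of_mem_interior_integrableExpSet
      hμ.zero_mem_interior n) p

lemma HasExpMoment.memLp_eval {μ : Measure ℝ} (hμ : HasExpMoment μ) (p : Polynomial ℝ) :
    MemLp (fun x => p.eval x) 2 μ := by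
  rw [memLp_two_iff_integrable_sq (by fun_prop)]
  simp_rw [← Polynomial.eval_pow]
  exact hμ.integrable_eval (p ^ 2)

/-- Members of a sequence with one polynomial of each degree span all polynomials. -/
lemma IsOrthogonalPolynomials.mem_of_forall_mem {μ : Measure ℝ} {α : ℕ → Polynomial ℝ}
    (hα : IsOrthogonalPolynomials μ α) {W : Submodule ℝ (Polynomial ℝ)} (h : ∀ n, α n ∈ W)
    (p : Polynomial ℝ) : p ∈ W := by
  have hne (n : ℕ) : α n ≠ 0 := fun h0 => by
    have := hα.normSq_pos n
    simp [normSqPoly, h0] at this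
  let s : Polynomial.Sequence ℝ :=
    ⟨α, fun n => by rw [Polynomial.degree_eq_natDegree (hne n), hα.natDegree_eq n]⟩
  have hs : Submodule.span ℝ (Set.range s) = ⊤ :=
    s.span fun n => isUnit_iff_ne_zero.2 (Polynomial.leadingCoeff_ne_zero.2 (s.ne_zero n))
  have hle : Submodule.span ℝ (Set.range s) ≤ W := by
    rw [Submodule.span_le]
    rintro _ ⟨n, rfl⟩
    exact h n
  exact hle (hs ▸ Submodule.mem_top)

lemma inner_toLp_eq_integral {μ : Measure ℝ} {φ ψ : ℝ → ℝ} (hφ : MemLp φ 2 μ)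
    (hψ : MemLp ψ 2 μ) : inner ℝ (hφ.toLp φ) (hψ.toLp ψ) = ∫ x, φ x * ψ x ∂μ := by
  rw [L2.inner_def]
  refine integral_congr_ae ?_
  filter_upwards [hφ.coeFn_toLp, hψ.coeFn_toLp] with x h₁ h₂
  rw [h₁, h₂]
  simp [mul_comm]

lemma memLp_partialSum {μ : Measure ℝ} (hμ : HasExpMoment μ) (α : ℕ → Polynomial ℝ) (c : ℕ → ℝ)
    (N : ℕ) : MemLp (fun x => ∑ n ∈ Finset.range N, c n * (α n).eval x / normSqPoly μ (α n)) 2 μ :=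
  memLp_finsetSum _ fun n _ => by
    simpa [mul_div_right_comm] using (hμ.memLp_eval (α n)).const_mul (c n / normSqPoly μ (α n))

/-- An orthogonal series with square-summable coefficients converges in mean square. -/
lemma IsOrthogonalPolynomials.exists_convergesInMeanSquare {μ : Measure ℝ} (hμ : HasExpMoment μ)
    {α : ℕ → Polynomial ℝ} (hα : IsOrthogonalPolynomials μ α) {c : ℕ → ℝ}
    (hc : Summable fun n => |c n| ^ 2 / normSqPoly μ (α n)) :
    ∃ g : ℝ → ℝ, ConvergesInMeanSquare μ α c g := by
  let v (n : ℕ) : Lp ℝ 2 μ := (hμ.memLp_eval (α n)).toLp _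
  have hsq (n : ℕ) : √(normSqPoly μ (α n)) * √(normSqPoly μ (α n)) = normSqPoly μ (α n) :=
    Real.mul_self_sqrt (hα.normSq_pos n).le
  have hvv (n : ℕ) : inner ℝ (v n) (v n) = normSqPoly μ (α n) := by
    simp only [v, inner_toLp_eq_integral, normSqPoly, sq]
  have ho : Orthonormal ℝ fun n => (√(normSqPoly μ (α n)))⁻¹ • v n := by
    rw [orthonormal_iff_ite]
    intro m n
    rw [real_inner_smul_left, real_inner_smul_right]
    split_ifs with hmn
    · subst hmn
      rw [hvv, ← mul_assoc, ← mul_inv, hsq, inv_mul_cancel₀ (hα.normSq_pos m).ne']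
    · rw [inner_toLp_eq_integral, hα.orthogonal m n hmn]
      simp
  -- Relative to the normalised vectors the coefficients are `c n / √‖α n‖²`, whose squares are the
  -- terms of `hc`.
  have hs := (ho.orthogonalFamily.summable_iff_norm_sq_summable
    fun n => c n / √(normSqPoly μ (α n))).2 (by
      refine hc.congr fun n => ?_
      rw [Real.norm_eq_abs, sq_abs, sq_abs, div_pow, Real.sq_sqrt (hα.normSq_pos n).le])
  set G : Lp ℝ 2 μ := ∑' n, LinearIsometry.toSpanSingleton ℝ (Lp ℝ 2 μ) (ho.1 n)
    (c n / √(normSqPoly μ (α n)))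
  have ht := hs.hasSum.tendsto_sum_nat
  refine ⟨G, Lp.memLp G, ?_⟩
  rw [Lp.tendsto_Lp_iff_tendsto_eLpNorm'] at ht
  refine ht.congr fun N => eLpNorm_congr_ae ?_
  have hN : ∑ n ∈ Finset.range N, LinearIsometry.toSpanSingleton ℝ (Lp ℝ 2 μ) (ho.1 n)
      (c n / √(normSqPoly μ (α n))) = (memLp_partialSum hμ α c N).toLp _ := by
    have (n : ℕ) : LinearIsometry.toSpanSingleton ℝ (Lp ℝ 2 μ) (ho.1 n)
        (c n / √(normSqPoly μ (α n))) = (c n / normSqPoly μ (α n)) • v n := by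
      rw [LinearIsometry.toSpanSingleton_apply, smul_smul]
      congr 1
      rw [← div_eq_mul_inv, div_div, hsq]
    simp_rw [this]
    refine Lp.ext ?_
    refine (Lp.coeFn_finsetSum _ _).trans ?_
    refine EventuallyEq.trans ?_ (MemLp.coeFn_toLp _).symm
    have hall : ∀ᵐ x ∂μ, ∀ n, ((c n / normSqPoly μ (α n)) • v n : Lp ℝ 2 μ) x =
        c n * (α n).eval x / normSqPoly μ (α n) := by
      refine ae_all_iff.2 fun n => ?_
      filter_upwards [Lp.coeFn_smul (c n / normSqPoly μ (α n)) (v n),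
        (hμ.memLp_eval (α n)).coeFn_toLp] with x h₁ h₂
      rw [h₁, Pi.smul_apply, h₂, smul_eq_mul]
      ring
    filter_upwards [hall] with x hx
    simp only [Finset.sum_apply, hx]
  rw [hN]
  exact (MemLp.coeFn_toLp _).sub .rfl

/-- Integrals of a mean-square convergent series against a square-integrable function. -/
lemma ConvergesInMeanSquare.tendsto_integral_mul {μ : Measure ℝ} (hμ : HasExpMoment μ)
    {α : ℕ → Polynomial ℝ} {c : ℕ → ℝ} {g : ℝ → ℝ} (hg : ConvergesInMeanSquare μ α c g)
    {φ : ℝ → ℝ} (hφ : MemLp φ 2 μ) :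
    Tendsto (fun N : ℕ => ∑ n ∈ Finset.range N,
      c n / normSqPoly μ (α n) * ∫ x, φ x * (α n).eval x ∂μ) atTop (𝓝 (∫ x, φ x * g x ∂μ)) := by
  have ht : Tendsto (fun N => (memLp_partialSum hμ α c N).toLp _) atTop (𝓝 (hg.1.toLp g)) :=
    (Lp.tendsto_Lp_iff_tendsto_eLpNorm'' _ _ _ _).2 hg.2
  -- Mean-square convergence passes through the continuous inner product with `φ`.
  have hin := ht.inner (𝕜 := ℝ) (tendsto_const_nhds (x := hφ.toLp φ))
  simp_rw [real_inner_comm (hφ.toLp φ), inner_toLp_eq_integral] at hin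
  refine hin.congr fun N => ?_
  simp_rw [Finset.mul_sum]
  rw [integral_finsetSum]
  · refine Finset.sum_congr rfl fun n _ => ?_
    rw [← integral_const_mul]
    exact integral_congr_ae (ae_of_all _ fun x => by ring)
  · intro n _
    have := (hφ.integrable_mul (hμ.memLp_eval (α n))).const_mul (c n / normSqPoly μ (α n))
    refine this.congr (ae_of_all _ fun x => ?_)
    simp only [Pi.mul_apply]
    ring

/-- The coefficients of a mean-square convergent orthogonal series. -/
lemma ConvergesInMeanSquare.integral_mul_eq {μ : Measure ℝ} (hμ : HasExpMoment μ)
    {α : ℕ → Polynomial ℝ} (hα : IsOrthogonalPolynomials μ α) {c : ℕ → ℝ} {g : ℝ → ℝ}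
    (hg : ConvergesInMeanSquare μ α c g) (m : ℕ) : ∫ x, (α m).eval x * g x ∂μ = c m := by
  refine tendsto_nhds_unique (hg.tendsto_integral_mul hμ (hμ.memLp_eval (α m))) ?_
  refine tendsto_const_nhds.congr' ?_
  filter_upwards [eventually_gt_atTop m] with N hN
  rw [Finset.sum_eq_single m]
  · have : ∫ x, (α m).eval x * (α m).eval x ∂μ = normSqPoly μ (α m) := by
      simp only [normSqPoly, sq]
    rw [this, div_mul_cancel₀ _ (hα.normSq_pos m).ne']
  · intro n _ hn
    rw [hα.orthogonal m n hn.symm, mul_zero]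
  · intro h
    exact absurd (Finset.mem_range.2 hN) h

/-! ### Measures with an L² density -/

section Density

variable {μ : Measure ℝ} {g φ : ℝ → ℝ}

lemma integrable_withDensity_ofReal (hg : MemLp g 2 μ) (hφ : MemLp φ 2 μ) :
    Integrable φ (μ.withDensity fun x => ENNReal.ofReal (g x)) := by
  rw [integrable_withDensity_iff_integrable_smul₀' hg.1.aemeasurable.ennreal_ofReal (by simp)]
  refine (hφ.integrable_mul hg).mono (by
    have := hg.1.aemeasurable.ennreal_ofReal.ennreal_toReal.aestronglyMeasurable
    exact this.smul hφ.1) (ae_of_all _ fun x => ?_)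
  simp only [Pi.mul_apply, norm_mul, norm_smul, mul_comm ‖φ x‖]
  refine mul_le_mul_of_nonneg_right ?_ (norm_nonneg _)
  rw [ENNReal.toReal_ofReal', Real.norm_eq_abs, Real.norm_eq_abs, abs_of_nonneg (le_max_right _ _)]
  exact max_le (le_abs_self _) (abs_nonneg _)

lemma integral_withDensity_ofReal (hg : MemLp g 2 μ) :
    ∫ x, φ x ∂(μ.withDensity fun x => ENNReal.ofReal (g x)) = ∫ x, φ x * max (g x) 0 ∂μ := by
  rw [integral_withDensity_eq_integral_toReal_smul₀ hg.1.aemeasurable.ennreal_ofReal (by simp)]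
  simp [ENNReal.toReal_ofReal', mul_comm]

/-- Cauchy–Schwarz costs half the exponent: `exp (δ|x|/2)` lies in L²(μ), so it is integrable
against an L² density. -/
lemma HasExpMoment.withDensity_ofReal (hμ : HasExpMoment μ) (hg : MemLp g 2 μ) :
    HasExpMoment (μ.withDensity fun x => ENNReal.ofReal (g x)) := by
  obtain ⟨δ, hδ, hint⟩ := hμ
  refine ⟨δ / 2, half_pos hδ, integrable_withDensity_ofReal hg ?_⟩
  rw [memLp_two_iff_integrable_sq (by fun_prop)]
  refine hint.congr (ae_of_all _ fun x => ?_)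
  simp only [sq, ← Real.exp_add]
  congr 1
  ring

end Density

/-! ### Representing measures and nonnegativity -/

section Representation

variable {μ ζ : Measure ℝ} {α : ℕ → Polynomial ℝ} {c : ℕ → ℝ} {g : ℝ → ℝ}

/-- A measure representing the coefficients of `g` integrates all polynomials as `g dμ` does. -/
lemma RepresentsCoefficients.integral_eval (hμ : HasExpMoment μ)
    (hα : IsOrthogonalPolynomials μ α) (hg : ConvergesInMeanSquare μ α c g)
    (hζ : RepresentsCoefficients μ α c ζ) (p : Polynomial ℝ) :
    Integrable (fun x => p.eval x) ζ ∧ ∫ x, p.eval x ∂ζ = ∫ x, p.eval x * g x ∂μ := by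
  have hI (p : Polynomial ℝ) : Integrable (fun x => p.eval x * g x) μ :=
    (hμ.memLp_eval p).integrable_mul hg.1
  let W : Submodule ℝ (Polynomial ℝ) :=
    { carrier := {p | Integrable (fun x => p.eval x) ζ ∧
        ∫ x, p.eval x ∂ζ = ∫ x, p.eval x * g x ∂μ}
      add_mem' := by
        rintro p q ⟨hp, hp'⟩ ⟨hq, hq'⟩
        refine ⟨by simpa only [Polynomial.eval_add] using hp.fun_add hq, ?_⟩
        simp only [Polynomial.eval_add, add_mul]
        rw [integral_add hp hq, integral_add (hI p) (hI q), hp', hq']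
      zero_mem' := by simp
      smul_mem' := by
        rintro a p ⟨hp, hp'⟩
        refine ⟨by simpa using hp.const_mul a, ?_⟩
        simp only [Polynomial.eval_smul, smul_eq_mul, mul_assoc]
        rw [integral_const_mul, integral_const_mul, hp'] }
  exact hα.mem_of_forall_mem (W := W)
    (fun n => ⟨hζ.integrable n, by rw [← hζ.coeff_eq n, hg.integral_mul_eq hμ hα n]⟩) p

/-- Moving the negative part of `g` to the other side turns equality of moments with the signed
measure `g dμ` into one between positive measures. Determinacy needs the exponential moment only for
the left side. -/
lemma RepresentsCoefficients.add_withDensity (hμ : HasExpMoment μ)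
    (hα : IsOrthogonalPolynomials μ α) (hg : ConvergesInMeanSquare μ α c g)
    (hζ : RepresentsCoefficients μ α c ζ) :
    μ.withDensity (fun x => ENNReal.ofReal (g x)) =
      ζ + μ.withDensity (fun x => ENNReal.ofReal (-g x)) := by
  have hng : MemLp (fun x => -g x) 2 μ := hg.1.neg
  have hX (n : ℕ) : MemLp (fun x : ℝ => x ^ n) 2 μ := by
    simpa using hμ.memLp_eval (Polynomial.X ^ n)
  have hr (n : ℕ) := hζ.integral_eval hμ hα hg (Polynomial.X ^ n)
  simp only [Polynomial.eval_pow, Polynomial.eval_X] at hr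
  refine (hμ.withDensity_ofReal hg.1).eq_of_moments
    (fun n => (hr n).1.add_measure (integrable_withDensity_ofReal hng (hX n))) fun n => ?_
  rw [integral_add_measure (hr n).1 (integrable_withDensity_ofReal hng (hX n)),
    integral_withDensity_ofReal hg.1, integral_withDensity_ofReal hng, (hr n).2, ← integral_add]
  · refine integral_congr_ae (ae_of_all _ fun x => ?_)
    simp only [← mul_add]
    congr 1
    rcases le_total (g x) 0 with h | h
    · rw [max_eq_right h, max_eq_left (by linarith)]; ring
    · rw [max_eq_left h, max_eq_right (by linarith)]; ring
  · exact (hX n).integrable_mul hg.1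
  · have hpos : MemLp (fun x => max (-g x) 0) 2 μ := hng.pos_part
    exact (hX n).integrable_mul hpos

/-- If the coefficients of `g` are represented by a positive measure, then `g` is nonnegative. -/
lemma RepresentsCoefficients.ae_nonneg (hμ : HasExpMoment μ)
    (hα : IsOrthogonalPolynomials μ α) (hg : ConvergesInMeanSquare μ α c g)
    (hζ : RepresentsCoefficients μ α c ζ) : ∀ᵐ x ∂μ, 0 ≤ g x := by
  have := hμ.isFiniteMeasure
  have hle : μ.withDensity (fun x => ENNReal.ofReal (-g x)) ≤
      μ.withDensity (fun x => ENNReal.ofReal (g x)) := by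
    rw [hζ.add_withDensity hμ hα hg]
    exact Measure.le_add_left le_rfl
  have hm := hg.1.1.aemeasurable
  have := ae_le_of_forall_setLIntegral_le_of_sigmaFinite₀ (μ := μ) hm.neg.ennreal_ofReal
    (g := fun x => ENNReal.ofReal (g x)) fun s hs _ => by
      rw [← withDensity_apply _ hs, ← withDensity_apply _ hs]
      exact hle s
  -- At a point with `g x < 0` the inequality `g⁻ ≤ g⁺` would read `-g x ≤ 0`.
  filter_upwards [this] with x hx
  by_contra hneg
  push Not at hneg
  rw [ENNReal.ofReal_of_nonpos hneg.le] at hx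
  have := ENNReal.ofReal_eq_zero.1 (le_antisymm hx zero_le)
  simp only [Pi.neg_apply] at this
  linarith

/-- A positive measure representing the coefficients of `g` has density `g`. -/
lemma RepresentsCoefficients.eq_withDensity (hμ : HasExpMoment μ)
    (hα : IsOrthogonalPolynomials μ α) (hg : ConvergesInMeanSquare μ α c g)
    (hζ : RepresentsCoefficients μ α c ζ) :
    ζ = μ.withDensity (fun x => ENNReal.ofReal (g x)) := by
  have h0 : μ.withDensity (fun x => ENNReal.ofReal (-g x)) = 0 := by
    have : (fun x => ENNReal.ofReal (-g x)) =ᵐ[μ] 0 := by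
      filter_upwards [hζ.ae_nonneg hμ hα hg] with x hx
      simpa using hx
    rw [withDensity_congr_ae this, withDensity_zero]
  rw [hζ.add_withDensity hμ hα hg, h0, add_zero]

/-- A nonnegative sum is the density of a measure representing its coefficients. -/
lemma ConvergesInMeanSquare.representsCoefficients (hμ : HasExpMoment μ)
    (hα : IsOrthogonalPolynomials μ α) (hg : ConvergesInMeanSquare μ α c g)
    (h0 : ∀ᵐ x ∂μ, 0 ≤ g x) :
    RepresentsCoefficients μ α c (μ.withDensity fun x => ENNReal.ofReal (g x)) where
  isFinite := (hμ.withDensity_ofReal hg.1).isFiniteMeasure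
  absolutelyContinuous := withDensity_absolutelyContinuous _ _
  integrable n := integrable_withDensity_ofReal hg.1 (hμ.memLp_eval _)
  coeff_eq n := by
    rw [integral_withDensity_ofReal hg.1, ← hg.integral_mul_eq hμ hα n]
    refine integral_congr_ae ?_
    filter_upwards [h0] with x hx
    rw [max_eq_left hx]

/-- A representing measure has mass one exactly if the zeroth coefficient is `α 0`. -/
lemma RepresentsCoefficients.isProbabilityMeasure_iff (hα : IsOrthogonalPolynomials μ α)
    (hζ : RepresentsCoefficients μ α c ζ) :
    IsProbabilityMeasure ζ ↔ c 0 = (α 0).coeff 0 := by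
  have := hζ.isFinite
  have hC : α 0 = Polynomial.C ((α 0).coeff 0) :=
    Polynomial.eq_C_of_natDegree_eq_zero (hα.natDegree_eq 0)
  have hne : (α 0).coeff 0 ≠ 0 := fun h => by
    have := hα.normSq_pos 0
    rw [hC, h] at this
    simp [normSqPoly] at this
  have hc : c 0 = ζ.real Set.univ * (α 0).coeff 0 := by
    rw [hζ.coeff_eq 0, hC]
    simp
  rw [hc, mul_eq_right₀ hne, isProbabilityMeasure_iff_real]

end Representation

/-! ### Kernels, mixtures and joint densities -/

section Mixture

variable {μ ν : Measure ℝ} {α : ℕ → Polynomial ℝ} {S : Set ℝ} {h : ℕ → ℝ → ℝ}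
  {g : ℝ → ℝ → ℝ} {ζ : ℝ → Measure ℝ}

lemma RepresentsCoefficients.apply_eq_ofReal_setIntegral {c : ℕ → ℝ} {u : ℝ → ℝ} {ξ : Measure ℝ}
    (hμ : HasExpMoment μ) (hα : IsOrthogonalPolynomials μ α) (hu : ConvergesInMeanSquare μ α c u)
    (hξ : RepresentsCoefficients μ α c ξ) {A : Set ℝ} (hA : MeasurableSet A) :
    ξ A = ENNReal.ofReal (∫ x in A, u x ∂μ) := by
  have := hμ.isFiniteMeasure
  rw [hξ.eq_withDensity hμ hα hu, withDensity_apply _ hA, ofReal_integral_eq_lintegral_ofReal]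
  · exact (hu.1.integrable one_le_two).integrableOn
  · exact ae_restrict_of_ae (hξ.ae_nonneg hμ hα hu)

/-- The representing measures of almost everywhere measurable coefficients form a kernel, up to a
null set of parameters. -/
lemma exists_kernel_of_representsCoefficients [IsProbabilityMeasure μ] (hμ : HasExpMoment μ)
    (hα : IsOrthogonalPolynomials μ α)
    (hg : ∀ y ∈ S, ConvergesInMeanSquare μ α (fun n => h n y) (fun x => g x y))
    (hζ : ∀ y ∈ S, IsProbabilityMeasure (ζ y) ∧
      RepresentsCoefficients μ α (fun n => h n y) (ζ y))
    (hS : ∀ᵐ y ∂ν, y ∈ S) (hh : ∀ n, AEMeasurable (h n) ν) :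
    ∃ (κ : ProbabilityTheory.Kernel ℝ ℝ) (T : Set ℝ), ProbabilityTheory.IsMarkovKernel κ ∧
      MeasurableSet T ∧ T ⊆ S ∧ (∀ᵐ y ∂ν, y ∈ T) ∧ ∀ y ∈ T, κ y = ζ y := by
  classical
  have hae : ∀ᵐ y ∂ν, y ∈ S ∧ ∀ n, h n y = (hh n).mk _ y :=
    hS.and (ae_all_iff.2 fun n => (hh n).ae_eq_mk)
  obtain ⟨T, hTν, hTm, hT⟩ := hae.exists_measurable_mem
  -- On `T` the coefficients equal measurable representatives, so `ζ y A` is a limit of measurable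
  -- partial sums integrated over `A`. Off `T` the probability measure `μ` is a filler that keeps
  -- the kernel Markov.
  have hmeas : Measurable fun y => if y ∈ T then ζ y else μ := by
    refine Measure.measurable_of_measurable_coe _ fun A hA => ?_
    refine measurable_of_tendsto_metrizable (f := fun (N : ℕ) y => if y ∈ T then
      ENNReal.ofReal (∑ n ∈ Finset.range N, (hh n).mk _ y / normSqPoly μ (α n) *
        ∫ x, A.indicator 1 x * (α n).eval x ∂μ) else μ A) (fun N => ?_) ?_
    · refine Measurable.ite hTm (Measurable.ennreal_ofReal ?_) measurable_const
      exact Finset.measurable_fun_sum _ fun n _ =>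
        (((hh n).measurable_mk.div_const _).mul_const _)
    · refine tendsto_pi_nhds.2 fun y => ?_
      by_cases hy : y ∈ T
      · simp only [if_pos hy]
        obtain ⟨hyS, hyn⟩ := hT y hy
        simp_rw [← hyn]
        rw [(hζ y hyS).2.apply_eq_ofReal_setIntegral hμ hα (hg y hyS) hA]
        have hind : MemLp (A.indicator (1 : ℝ → ℝ)) 2 μ :=
          memLp_indicator_const 2 hA 1 (Or.inr (measure_ne_top _ _))
        have := (hg y hyS).tendsto_integral_mul hμ hind
        have e : ∫ x, A.indicator (1 : ℝ → ℝ) x * g x y ∂μ = ∫ x in A, g x y ∂μ := by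
          rw [← integral_indicator hA]
          congr 1 with x
          by_cases hx : x ∈ A <;> simp [hx]
        rw [e] at this
        exact (ENNReal.continuous_ofReal.tendsto _).comp this
      · simp only [if_neg hy]
        exact tendsto_const_nhds
  refine ⟨⟨fun y => if y ∈ T then ζ y else μ, hmeas⟩, T, ⟨fun y => ?_⟩, hTm,
    fun y hy => (hT y hy).1, hTν, fun y hy => if_pos hy⟩
  change IsProbabilityMeasure (if y ∈ T then ζ y else μ)
  split_ifs with hy
  · exact (hζ y (hT y hy).1).1
  · infer_instance

/-- If the averaged coefficients are those of `μ`, then the mixture of the representing measures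
is `μ`. -/
lemma comp_eq_of_integral_coeff [IsProbabilityMeasure ν] (hμ : HasExpMoment μ)
    (hα : IsOrthogonalPolynomials μ α) (κ : ProbabilityTheory.Kernel ℝ ℝ)
    [ProbabilityTheory.IsMarkovKernel κ]
    (hκ : ∀ᵐ y ∂ν, RepresentsCoefficients μ α (fun n => h n y) (κ y))
    (hi : ∀ n, Integrable (h n) ν) (hint : ∀ n, ∫ y, h n y ∂ν = ∫ x, (α n).eval x ∂μ) :
    ν.bind κ = μ := by
  -- Integrability for almost every `y` and of the inner integral is carried along, so that the
  -- identity is closed under sums.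
  let W : Submodule ℝ (Polynomial ℝ) :=
    { carrier := {p | (∀ᵐ y ∂ν, Integrable (fun x => p.eval x) (κ y)) ∧
        Integrable (fun y => ∫ x, p.eval x ∂κ y) ν ∧
        ∫ y, ∫ x, p.eval x ∂κ y ∂ν = ∫ x, p.eval x ∂μ}
      add_mem' := by
        rintro p q ⟨hp, hp', hp''⟩ ⟨hq, hq', hq''⟩
        have e : (fun y => ∫ x, (p + q).eval x ∂κ y) =ᵐ[ν]
            fun y => ∫ x, p.eval x ∂κ y + ∫ x, q.eval x ∂κ y := by
          filter_upwards [hp, hq] with y h₁ h₂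
          simp only [Polynomial.eval_add]
          exact integral_add h₁ h₂
        refine ⟨?_, (hp'.add hq').congr e.symm, ?_⟩
        · filter_upwards [hp, hq] with y h₁ h₂
          simpa only [Polynomial.eval_add] using h₁.fun_add h₂
        · rw [integral_congr_ae e, integral_add hp' hq', hp'', hq'']
          simp only [Polynomial.eval_add]
          exact (integral_add (hμ.integrable_eval p) (hμ.integrable_eval q)).symm
      zero_mem' := by simp
      smul_mem' := by
        rintro a p ⟨hp, hp', hp''⟩
        have e (ξ : Measure ℝ) : ∫ x, (a • p).eval x ∂ξ = a * ∫ x, p.eval x ∂ξ := by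
          simp only [Polynomial.eval_smul, smul_eq_mul]
          exact integral_const_mul _ _
        refine ⟨?_, ?_, ?_⟩
        · filter_upwards [hp] with y h₁
          simpa only [Polynomial.eval_smul, smul_eq_mul] using h₁.const_mul a
        · simp_rw [e]
          exact hp'.const_mul a
        · simp_rw [e]
          rw [integral_const_mul, hp''] }
  have hW (p : Polynomial ℝ) : p ∈ W := hα.mem_of_forall_mem (fun n => by
    have e : h n =ᵐ[ν] fun y => ∫ x, (α n).eval x ∂κ y := hκ.mono fun y hy => hy.coeff_eq n
    exact ⟨hκ.mono fun y hy => hy.integrable n, (hi n).congr e,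
      by rw [← integral_congr_ae e, hint n]⟩) p
  have hpow (n : ℕ) : (∀ᵐ y ∂ν, Integrable (fun x : ℝ => x ^ n) (κ y)) ∧
      Integrable (fun y => ∫ x, x ^ n ∂κ y) ν ∧ ∫ y, ∫ x, x ^ n ∂κ y ∂ν = ∫ x, x ^ n ∂μ := by
    have := hW (Polynomial.X ^ n)
    simpa only [W, Submodule.mem_mk, AddSubmonoid.mem_mk, AddSubsemigroup.mem_mk, Set.mem_ofPred_eq,
      Polynomial.eval_pow, Polynomial.eval_X] using this
  -- Integrability for the mixture needs control of the averaged absolute moments. Even powers equal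
  -- their absolute values; the others follow from `|x|^n ≤ x^(2n) + 1`.
  have heven (n : ℕ) : Integrable (fun x : ℝ => x ^ (2 * n)) (ν.bind κ) := by
    rw [Measure.integrable_comp_iff (by fun_prop)]
    refine ⟨(hpow _).1, ?_⟩
    simp_rw [Real.norm_of_nonneg ((even_two_mul n).pow_nonneg _)]
    exact (hpow _).2.1
  have hall (n : ℕ) : Integrable (fun x : ℝ => x ^ n) (ν.bind κ) := by
    refine ((heven n).add (integrable_const (1 : ℝ))).mono' (by fun_prop) (ae_of_all _ fun x => ?_)
    simp only [Pi.add_apply, norm_pow, Real.norm_eq_abs, mul_comm 2 n, pow_mul]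
    rw [← sq_abs (x ^ n), abs_pow]
    nlinarith [sq_nonneg (|x| ^ n - 1), sq_nonneg (|x| ^ n)]
  refine (hμ.eq_of_moments hall fun n => ?_).symm
  have := hall n
  rw [Measure.comp_eq_comp_const_apply] at this ⊢
  rw [ProbabilityTheory.Kernel.integral_comp this, ← (hpow n).2.2]
  simp

/-- A kernel with densities with respect to a fixed measure has a jointly measurable density. -/
lemma exists_measurable_density [IsFiniteMeasure μ] (κ : ProbabilityTheory.Kernel ℝ ℝ)
    [ProbabilityTheory.IsFiniteKernel κ] {T : Set ℝ}
    (hκ : ∀ y ∈ T, κ y = μ.withDensity fun x => ENNReal.ofReal (g x y))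
    (hgm : ∀ y ∈ T, AEMeasurable (fun x => g x y) μ) (hg0 : ∀ y ∈ T, ∀ᵐ x ∂μ, 0 ≤ g x y) :
    ∃ f : ℝ → ℝ → ℝ, Measurable (fun p : ℝ × ℝ => f p.1 p.2) ∧
      ∀ y ∈ T, ∀ᵐ x ∂μ, f x y = g x y := by
  let η : ProbabilityTheory.Kernel ℝ ℝ := ProbabilityTheory.Kernel.const ℝ μ
  refine ⟨fun x y => (ProbabilityTheory.Kernel.rnDeriv κ η y x).toReal,
    ((ProbabilityTheory.Kernel.measurable_rnDeriv κ η).comp measurable_swap).ennreal_toReal,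
    fun y hy => ?_⟩
  have h₁ := ProbabilityTheory.Kernel.rnDeriv_eq_rnDeriv_measure (κ := κ) (η := η) (a := y)
  rw [hκ y hy] at h₁
  filter_upwards [h₁, Measure.rnDeriv_withDensity₀ μ (hgm y hy).ennreal_ofReal, hg0 y hy]
    with x h₁ h₂ h₃
  rw [h₁]
  simp only [η, ProbabilityTheory.Kernel.const_apply, h₂]
  exact ENNReal.toReal_ofReal h₃

end Mixture

/-- For `n > 0` this is orthogonality to the nonzero constant `α 0`. -/
lemma IsOrthogonalPolynomials.integral_eval {μ : Measure ℝ} [IsProbabilityMeasure μ]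
    {α : ℕ → Polynomial ℝ} (hα : IsOrthogonalPolynomials μ α) (n : ℕ) :
    ∫ x, (α n).eval x ∂μ = if n = 0 then (α 0).coeff 0 else 0 := by
  have hC : α 0 = Polynomial.C ((α 0).coeff 0) :=
    Polynomial.eq_C_of_natDegree_eq_zero (hα.natDegree_eq 0)
  split_ifs with hn
  · rw [hn, hC]
    simp
  · have ho := hα.orthogonal 0 n (Ne.symm hn)
    have hne : (α 0).coeff 0 ≠ 0 := fun h => by
      have := hα.normSq_pos 0
      rw [hC, h] at this
      simp [normSqPoly] at this
    rw [hC] at ho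
    simp only [Polynomial.eval_C] at ho
    rw [integral_const_mul] at ho
    exact (mul_eq_zero.1 ho).resolve_left hne

/-! ### The main theorem -/

theorem theorem2 (μ : Measure ℝ) (hμ : HasExpMoment μ)
    (α : ℕ → Polynomial ℝ) (hα : IsOrthogonalPolynomials μ α)
    (S : Set ℝ) (hS : IsClosed S) (h : ℕ → ℝ → ℝ)
    (hh : ∀ y ∈ S, Summable fun n => |h n y| ^ 2 / normSqPoly μ (α n)) :
    -- the series converges in mean square for every `y ∈ S`
    (∃ g : ℝ → ℝ → ℝ,
      ∀ y ∈ S, ConvergesInMeanSquare μ α (fun n => h n y) (fun x => g x y)) ∧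
    -- and its sum `g` has the following properties
    ∀ g : ℝ → ℝ → ℝ,
      (∀ y ∈ S, ConvergesInMeanSquare μ α (fun n => h n y) (fun x => g x y)) →
      -- nonnegative sums correspond to families of positive measures
      ((∀ y ∈ S, ∀ᵐ x ∂μ, 0 ≤ g x y) ↔
        ∃ ζ : ℝ → Measure ℝ, ∀ y ∈ S, RepresentsCoefficients μ α (fun n => h n y) (ζ y)) ∧
      -- nonnegative sums of total mass one correspond to families of probability measures
      ((∀ y ∈ S, (∀ᵐ x ∂μ, 0 ≤ g x y) ∧ h 0 y = (α 0).coeff 0) ↔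
        ∃ ζ : ℝ → Measure ℝ, ∀ y ∈ S, IsProbabilityMeasure (ζ y) ∧
          RepresentsCoefficients μ α (fun n => h n y) (ζ y)) ∧
      -- each such family has the density `g (·, y)`
      (∀ ζ : ℝ → Measure ℝ,
        (∀ y ∈ S, RepresentsCoefficients μ α (fun n => h n y) (ζ y)) →
        ∀ y ∈ S, ζ y = μ.withDensity (fun x => ENNReal.ofReal (g x y))) ∧
      -- the bivariate measure
      (IsProbabilityMeasure μ →
        ∀ ζ : ℝ → Measure ℝ,
          (∀ y ∈ S, IsProbabilityMeasure (ζ y) ∧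
            RepresentsCoefficients μ α (fun n => h n y) (ζ y)) →
        ∀ ν : Measure ℝ, IsProbabilityMeasure ν → ν Sᶜ = 0 →
          (∀ n, IntegrableOn (h n) S ν) →
          (∀ n, ∫ y in S, h n y ∂ν = if n = 0 then 1 else 0) →
          (∀ A : Set ℝ, MeasurableSet A →
            AEMeasurable (fun y => ζ y A) (ν.restrict S) ∧ μ A = ∫⁻ y in S, ζ y A ∂ν) ∧
          ∃ F : Measure (ℝ × ℝ),
            IsProbabilityMeasure F ∧ F ≪ μ.prod ν ∧
            (∀ E : Set (ℝ × ℝ), MeasurableSet E →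
              F E = ∫⁻ y in S, ζ y {x | (x, y) ∈ E} ∂ν) ∧
            (∃ f : ℝ → ℝ → ℝ,
              AEMeasurable (fun p : ℝ × ℝ => f p.1 p.2) (μ.prod ν) ∧
              (∀ y ∈ S, ∀ᵐ x ∂μ, f x y = g x y) ∧
              F = (μ.prod ν).withDensity (fun p => ENNReal.ofReal (f p.1 p.2))) ∧
            F.map Prod.fst = μ ∧ F.map Prod.snd = ν) := by
  have hfin := hμ.isFiniteMeasure
  constructor
  · have hex (y : ℝ) : ∃ u : ℝ → ℝ, y ∈ S → ConvergesInMeanSquare μ α (fun n => h n y) u := by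
      by_cases hy : y ∈ S
      · obtain ⟨u, hu⟩ := hα.exists_convergesInMeanSquare hμ (hh y hy)
        exact ⟨u, fun _ => hu⟩
      · exact ⟨0, fun h' => absurd h' hy⟩
    choose u hu using hex
    exact ⟨fun x y => u y x, hu⟩
  intro g hg
  refine ⟨⟨fun h0 => ⟨_, fun y hy => (hg y hy).representsCoefficients hμ hα (h0 y hy)⟩, ?_⟩,
    ⟨fun h0 => ⟨fun y => μ.withDensity fun x => ENNReal.ofReal (g x y), fun y hy => ?_⟩, ?_⟩,
    fun ζ hζ y hy => (hζ y hy).eq_withDensity hμ hα (hg y hy), ?_⟩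
  · rintro ⟨ζ, hζ⟩ y hy
    exact (hζ y hy).ae_nonneg hμ hα (hg y hy)
  · have hr := (hg y hy).representsCoefficients hμ hα (h0 y hy).1
    exact ⟨(hr.isProbabilityMeasure_iff hα).2 (h0 y hy).2, hr⟩
  · rintro ⟨ζ, hζ⟩ y hy
    exact ⟨(hζ y hy).2.ae_nonneg hμ hα (hg y hy),
      ((hζ y hy).2.isProbabilityMeasure_iff hα).1 (hζ y hy).1⟩
  intro hμp ζ hζ ν hνp hνS hhi hhint
  classical
  have hS' : ∀ᵐ y ∂ν, y ∈ S := by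
    rw [ae_iff]
    exact hνS
  have hres : ν.restrict S = ν := Measure.restrict_eq_self_of_ae_mem hS'
  simp only [IntegrableOn, hres] at hhi hhint ⊢
  obtain ⟨κ, T, hκM, hTm, hTS, hTν, hκζ⟩ :=
    exists_kernel_of_representsCoefficients hμ hα hg hζ hS' fun n => (hhi n).aemeasurable
  -- Unit mass of `ζ y` makes `h 0` constantly `α 0` on `S`, and its `ν`-average is 1. The
  -- normalisation `α 0 = 1` is thus forced, and the averages `δ_{n,0}` are exactly `∫ α n dμ`.
  have hcoeff0 : (α 0).coeff 0 = 1 := by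
    have h₁ : ∫ y, h 0 y ∂ν = (α 0).coeff 0 := by
      rw [integral_congr_ae (hS'.mono fun y hy =>
        ((hζ y hy).2.isProbabilityMeasure_iff hα).1 (hζ y hy).1)]
      simp
    rw [← h₁, hhint 0, if_pos rfl]
  have hmix : ν.bind κ = μ := by
    refine comp_eq_of_integral_coeff hμ hα κ ?_ hhi fun n => ?_
    · filter_upwards [hTν] with y hy
      rw [hκζ y hy]
      exact (hζ y (hTS hy)).2
    · rw [hhint n, hα.integral_eval n, hcoeff0]
  have hζκ (A : ℝ → Set ℝ) : (fun y => ζ y (A y)) =ᵐ[ν] fun y => κ y (A y) := by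
    filter_upwards [hTν] with y hy
    rw [hκζ y hy]
  have hmarg (A : Set ℝ) (hA : MeasurableSet A) : μ A = ∫⁻ y, ζ y A ∂ν := by
    rw [lintegral_congr_ae (hζκ fun _ => A), ← Measure.bind_apply hA κ.aemeasurable, hmix]
  refine ⟨fun A hA => ⟨(κ.measurable_coe hA).aemeasurable.congr (hζκ fun _ => A).symm,
    hmarg A hA⟩, ?_⟩
  have hdens (y : ℝ) (hy : y ∈ S) := (hζ y hy).2.eq_withDensity hμ hα (hg y hy)
  obtain ⟨f₀, hf₀m, hf₀⟩ := exists_measurable_density (μ := μ) κ (T := T) (g := g)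
    (fun y hy => by rw [hκζ y hy, hdens y (hTS hy)])
    (fun y hy => (hg y (hTS hy)).1.1.aemeasurable)
    (fun y hy => (hζ y (hTS hy)).2.ae_nonneg hμ hα (hg y (hTS hy)))
  -- Keeping `g` off `T` makes `f` a modification of `g` for every `y ∈ S`. As `T` has full
  -- `ν`-measure, `f` stays a.e. equal to the measurable `f₀`.
  let f (x y : ℝ) : ℝ := if y ∈ T then f₀ x y else g x y
  have hff₀ : (fun p : ℝ × ℝ => f p.1 p.2) =ᵐ[μ.prod ν] fun p => f₀ p.1 p.2 := by
    filter_upwards [Measure.quasiMeasurePreserving_snd.ae hTν] with p hp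
    exact if_pos hp
  set F : Measure (ℝ × ℝ) := (μ.prod ν).withDensity fun p => ENNReal.ofReal (f p.1 p.2) with hF
  have hF₀ : F = (μ.prod ν).withDensity fun p => ENNReal.ofReal (f₀ p.1 p.2) :=
    withDensity_congr_ae (hff₀.mono fun p hp => congrArg ENNReal.ofReal hp)
  have hFE (E : Set (ℝ × ℝ)) (hE : MeasurableSet E) :
      F E = ∫⁻ y, ζ y {x | (x, y) ∈ E} ∂ν := by
    rw [hF₀, withDensity_apply _ hE, ← lintegral_indicator hE,
      lintegral_prod_symm' _ (hf₀m.ennreal_ofReal.indicator hE)]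
    refine lintegral_congr_ae ?_
    filter_upwards [hTν] with y hy
    have hEy : MeasurableSet {x | (x, y) ∈ E} := measurable_prodMk_right hE
    rw [hdens y (hTS hy), withDensity_apply _ hEy, ← lintegral_indicator hEy]
    refine lintegral_congr_ae ?_
    filter_upwards [hf₀ y hy] with x hx
    simp only [Set.indicator_apply, Set.mem_ofPred_eq, hx]
  have hfst : F.map Prod.fst = μ := by
    ext A hA
    rw [Measure.map_apply measurable_fst hA, hFE _ (measurable_fst hA), hmarg A hA]
    rfl
  refine ⟨F, ⟨?_⟩, withDensity_absolutelyContinuous _ _, hFE, ⟨f, ?_, ?_, hF⟩, hfst, ?_⟩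
  · rw [← Set.preimage_univ (f := Prod.fst), ← Measure.map_apply measurable_fst .univ, hfst,
      measure_univ]
  · exact ⟨_, hf₀m, hff₀⟩
  · intro y hy
    by_cases hyT : y ∈ T
    · filter_upwards [hf₀ y hyT] with x hx
      simp only [f, if_pos hyT, hx]
    · exact ae_of_all _ fun x => if_neg hyT
  · ext B hB
    rw [Measure.map_apply measurable_snd hB, hFE _ (measurable_snd hB),
      ← lintegral_indicator_one hB]
    refine lintegral_congr_ae ?_
    filter_upwards [hS'] with y hy
    have := (hζ y hy).1
    by_cases hyB : y ∈ B <;> simp [hyB]
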